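/- Let $n\ge 1$ and let $f=\sum_{\alpha} b_\alpha \mathbf z^\alpha\in\mathbb C[z_1^{\pm1},\dots,z_n^{\pm1}]$ be a Laurent polynomial. Its Newton polytope $\mathrm{New}(f)\subset\mathbb R^n$ is the convex hull of all $\alpha\in\mathbb Z^n$ with $b_\alpha\neq 0$, and its amoeba $\mathcal A(f)\subset\mathbb R^n$ is the image of $\{\mathbf z\in(\mathbb C\setminus\{0\})^n : f(\mathbf z)=0\}$ under $\mathbf z\mapsto(\log|z_1|,\dots,\log|z_n|)$. Suppose that $\mathrm{New}(f)$ is a simplex (the convex hull of $k+1$ affinely independent points for some $k\ge 0$; in particular $f\neq0$) and that $f$ is maximally sparse, i.e. $b_\alpha=0$ whenever $\alpha$ is not a vertex of $\mathrm{New}(f)$. Then $\mathcal A(f)$ is solid: the number of connected components of $\mathbb R^n\setminus\mathcal A(f)$ equals the number of vertices of $\mathrm{New}(f)$. Moreover, no connected component of $\mathbb R^n\setminus\mathcal A(f)$ is bounded. -/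

import Mathlib

/-- Complex Laurent polynomials in `n` variables: the group algebra of the exponent lattice `ℤⁿ`. -/
abbrev MvLaurent (n : ℕ) : Type := AddMonoidAlgebra ℂ (Fin n → ℤ)

namespace MvLaurent

variable {n : ℕ}

/-- The set of exponents that occur in `f` with a nonzero coefficient. -/
def supp (f : MvLaurent n) : Finset (Fin n → ℤ) := f.coeff.support

/-- The value of `f` at a point of the algebraic torus `(ℂ \ {0})ⁿ`. -/
noncomputable def eval (f : MvLaurent n) (z : Fin n → ℂˣ) : ℂ :=
  ∑ a ∈ f.supp, f.coeff a * ∏ j, (z j : ℂ) ^ a j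

/-- The zero set of `f` in the algebraic torus. -/
def zeroLocus (f : MvLaurent n) : Set (Fin n → ℂˣ) := {z | f.eval z = 0}

/-- An exponent vector, as a point of `ℝⁿ`. -/
def toReal (a : Fin n → ℤ) : Fin n → ℝ := fun j => (a j : ℝ)

/-- The Newton polytope: the convex hull in `ℝⁿ` of the exponents of `f`. -/
def newtonPolytope (f : MvLaurent n) : Set (Fin n → ℝ) :=
  convexHull ℝ (toReal '' (f.supp : Set (Fin n → ℤ)))

/-- The vertices of the Newton polytope. -/
def newtonVertices (f : MvLaurent n) : Set (Fin n → ℝ) :=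
  Set.extremePoints ℝ f.newtonPolytope

/-- Every exponent of `f` is a vertex of the Newton polytope: non-vertices have coefficient zero. -/
def MaximallySparse (f : MvLaurent n) : Prop :=
  ∀ a : Fin n → ℤ, toReal a ∉ f.newtonVertices → f.coeff a = 0

/-- The log-absolute-value map `(ℂ \ {0})ⁿ → ℝⁿ`. -/
noncomputable def logAbs (z : Fin n → ℂˣ) : Fin n → ℝ := fun j => Real.log ‖(z j : ℂ)‖

/-- The amoeba of `f`. -/
def amoeba (f : MvLaurent n) : Set (Fin n → ℝ) := logAbs '' f.zeroLocus

/-- The connected components of the complement of the amoeba of `f`. -/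
def complementComponents (f : MvLaurent n) : Set (Set (Fin n → ℝ)) :=
  {C | ∃ w ∈ f.amoebaᶜ, C = connectedComponentIn f.amoebaᶜ w}

/-- The amoeba of `f` is solid: the number of components of its complement is as small as possible,
namely the number of vertices of the Newton polytope. -/
def HasSolidAmoeba (f : MvLaurent n) : Prop :=
  f.complementComponents.encard = f.newtonVertices.encard

end MvLaurent

/-- A simplex, of arbitrary dimension `k`: the convex hull of `k + 1` affinely independent points. -/
def IsSimplexSet {n : ℕ} (P : Set (Fin n → ℝ)) : Prop :=
  ∃ (k : ℕ) (s : Affine.Simplex ℝ (Fin n → ℝ) k), P = convexHull ℝ (Set.range s.points)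

/-! ### Polygon inequalities, affine interpolation, connected components -/

section General

/-! Over a point w of the amoeba the terms of f have moduli `monomialNorm a w` and can sum to zero,
so none exceeds the sum of the others. Conversely, if none does, complex numbers of these moduli can
be chosen with sum zero (`exists_unit_sum_eq`). The exponents are vertices of a simplex, hence
affinely independent, so the arguments of the variables can be chosen to give the terms these phases
up to a common factor (`mem_amoeba_of_forall_notMem`). The complement of the amoeba is thus the
disjoint union of the dominant regions, one per exponent (`compl_amoeba_eq`). Each is open and
convex, and it is nonempty and unbounded because its monomial outgrows the others along some
direction (`exists_direction`). These regions are therefore the components. -/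

theorem exists_unit_mul_eq_norm (z : ℂ) : ∃ c : ℂ, ‖c‖ = 1 ∧ c * z = (‖z‖ : ℂ) := by
  by_cases hz : z = 0
  · exact ⟨1, by simp, by simp [hz]⟩
  · have hn : (‖z‖ : ℂ) ≠ 0 := by simpa using hz
    refine ⟨(‖z‖ : ℂ) / z, by simp [hz], by field_simp⟩

/-- Two complex numbers of given moduli can be chosen with a given sum, as soon as the triangle
inequalities hold. -/
theorem exists_unit_triangle {t r ρ : ℝ} (ht : 0 ≤ t) (hr : 0 ≤ r) (h₁ : ρ ≤ t + r)
    (h₂ : |t - r| ≤ ρ) :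
    ∃ a b : ℂ, ‖a‖ = 1 ∧ ‖b‖ = 1 ∧ a * t + b * r = (ρ : ℂ) := by
  -- As θ runs from 0 to π, the modulus passes continuously from t + r to |t - r|.
  let g : ℝ → ℝ := fun θ => ‖(t : ℂ) + r * Complex.exp (θ * Complex.I)‖
  have hg : Continuous g := by fun_prop
  have g0 : g 0 = t + r := by
    simp only [g, Complex.ofReal_zero, zero_mul, Complex.exp_zero, mul_one]
    rw [← Complex.ofReal_add, Complex.norm_real, Real.norm_of_nonneg (by positivity)]
  have gpi : g Real.pi = |t - r| := by
    simp only [g, Complex.exp_pi_mul_I, mul_neg, mul_one]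
    rw [← sub_eq_add_neg, ← Complex.ofReal_sub, Complex.norm_real, Real.norm_eq_abs]
  obtain ⟨θ, -, hθ⟩ := intermediate_value_Icc' Real.pi_pos.le hg.continuousOn
    (show ρ ∈ Set.Icc (g Real.pi) (g 0) by rw [g0, gpi]; exact ⟨h₂, h₁⟩)
  obtain ⟨c, hc, hcz⟩ := exists_unit_mul_eq_norm ((t : ℂ) + r * Complex.exp (θ * Complex.I))
  refine ⟨c, c * Complex.exp (θ * Complex.I), hc, ?_, ?_⟩
  · rw [norm_mul, hc, Complex.norm_exp_ofReal_mul_I, one_mul]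
  · rw [show ρ = _ from hθ.symm, ← hcz]
    ring

/-- Complex numbers of given moduli `r i` can be chosen with sum `ρ`, as soon as the polygon
inequalities hold. -/
theorem exists_unit_sum_eq {ι : Type*} (s : Finset ι) (r : ι → ℝ) (hr : ∀ i ∈ s, 0 ≤ r i)
    {ρ : ℝ} (h₀ : 0 ≤ ρ) (h₁ : ρ ≤ ∑ i ∈ s, r i)
    (h₂ : ∀ j ∈ s, 2 * r j ≤ (∑ i ∈ s, r i) + ρ) :
    ∃ u : ι → ℂ, (∀ i, ‖u i‖ = 1) ∧ ∑ i ∈ s, u i * r i = (ρ : ℂ) := by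
  classical
  induction s using Finset.induction_on generalizing ρ with
  | empty =>
    refine ⟨fun _ => 1, by simp, ?_⟩
    have : ρ = 0 := le_antisymm (by simpa using h₁) h₀
    simp [this]
  | insert k s hk ih =>
    rw [Finset.sum_insert hk] at h₁ h₂
    have hrk : 0 ≤ r k := hr k (Finset.mem_insert_self k s)
    have hrs : ∀ i ∈ s, 0 ≤ r i := fun i hi => hr i (Finset.mem_insert_of_mem hi)
    have hk2 := h₂ k (Finset.mem_insert_self k s)
    have hs2 : ∀ j ∈ s, 2 * r j ≤ r k + ∑ i ∈ s, r i + ρ :=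
      fun j hj => h₂ j (Finset.mem_insert_of_mem hj)
    have hS : 0 ≤ ∑ i ∈ s, r i := Finset.sum_nonneg hrs
    have hle : ∀ j ∈ s, r j ≤ ∑ i ∈ s, r i := fun j hj => Finset.single_le_sum hrs hj
    set S := ∑ i ∈ s, r i with hSdef
    obtain ⟨t, htS, ht1, ht2, ht3⟩ : ∃ t, t ≤ S ∧ |ρ - r k| ≤ t ∧ t ≤ ρ + r k ∧
        ∀ j ∈ s, 2 * r j ≤ S + t := by
      -- t will be the modulus of the sum over s. Apart from the two upper bounds S and ρ + r k, all
      -- constraints on t are lower bounds, so the largest admissible value is taken.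
      refine ⟨min S (ρ + r k), min_le_left _ _, ?_, min_le_right _ _, fun j hj => ?_⟩
      · rw [le_min_iff]
        constructor <;> rw [abs_le] <;> constructor <;> linarith
      · rcases min_cases S (ρ + r k) with h | h <;> rw [h.1]
        · linarith [hle j hj]
        · linarith [hs2 j hj]
    have ht0 : 0 ≤ t := (abs_nonneg _).trans ht1
    obtain ⟨u, hu, hus⟩ := ih hrs ht0 htS ht3
    rw [abs_le] at ht1
    obtain ⟨a, b, ha, hb, hab⟩ := exists_unit_triangle (t := t) (r := r k) (ρ := ρ) ht0 hrk
      (by linarith) (by rw [abs_le]; constructor <;> linarith)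
    refine ⟨fun i => if i = k then b else a * u i, fun i => ?_, ?_⟩
    · by_cases h : i = k <;> simp [h, hb, ha, hu]
    · rw [Finset.sum_insert hk, ← hab, ← hus, Finset.mul_sum, add_comm]
      congr 1
      · refine Finset.sum_congr rfl fun i hi => ?_
        simp only [if_neg (ne_of_mem_of_not_mem hi hk), mul_assoc]
      · simp

/-- An affine function takes prescribed values on an affinely independent family. -/
theorem AffineIndependent.exists_dotProduct_add_eq {ι : Type*} {n : ℕ} {p : ι → Fin n → ℝ}
    (hp : AffineIndependent ℝ p) (φ : ι → ℝ) :
    ∃ (v : Fin n → ℝ) (c : ℝ), ∀ i, p i ⬝ᵥ v + c = φ i := by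
  rcases isEmpty_or_nonempty ι with h | ⟨⟨i₀⟩⟩
  · exact ⟨0, 0, fun i => h.elim i⟩
  have hli := (affineIndependent_iff_linearIndependent_vsub ℝ p i₀).1 hp
  -- The differences from the base point are independent: prescribe a functional on their span and
  -- extend it.
  obtain ⟨g, hg⟩ := LinearMap.exists_extend
    ((Module.Basis.span hli).constr ℝ fun i : {x // x ≠ i₀} => φ i - φ i₀)
  have hgi : ∀ i, g (p i - p i₀) = φ i - φ i₀ := by
    intro i
    by_cases hi : i = i₀
    · simp [hi]
    · have h1 := LinearMap.congr_fun hg (Module.Basis.span hli ⟨i, hi⟩)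
      rw [Module.Basis.constr_basis] at h1
      simpa [Module.Basis.span_apply] using h1
  have hdot : ∀ x, g x = x ⬝ᵥ fun j => g (fun k => if j = k then 1 else 0) := by
    intro x
    rw [LinearMap.pi_apply_eq_sum_univ g x]
    rfl
  refine ⟨fun j => g (fun k => if j = k then 1 else 0), φ i₀ - g (p i₀), fun i => ?_⟩
  rw [← hdot]
  have := hgi i
  rw [map_sub] at this
  linarith

/-- The component of a disjoint union of connected open sets at a point is the member of the
family that contains the point. -/
theorem connectedComponentIn_biUnion_eq {X ι : Type*} [TopologicalSpace X] {s : Set ι}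
    {U : ι → Set X} (ho : ∀ i ∈ s, IsOpen (U i)) (hc : ∀ i ∈ s, IsPreconnected (U i))
    (hd : s.PairwiseDisjoint U) {i : ι} (hi : i ∈ s) {x : X} (hx : x ∈ U i) :
    connectedComponentIn (⋃ j ∈ s, U j) x = U i := by
  have hsub : U i ⊆ ⋃ j ∈ s, U j := Set.subset_biUnion_of_mem hi
  refine subset_antisymm ?_ ((hc i hi).subset_connectedComponentIn hx hsub)
  -- The component meets U i and is covered by two disjoint open sets, U i and the union of the
  -- other members.
  refine isPreconnected_connectedComponentIn.subset_left_of_subset_union (ho i hi)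
    (v := ⋃ j ∈ s \ {i}, U j) (isOpen_biUnion fun j hj => ho j hj.1) ?_ ?_
    ⟨x, mem_connectedComponentIn (hsub hx), hx⟩
  · rw [Set.disjoint_iUnion₂_right]
    exact fun j hj => hd hi hj.1 (fun h => hj.2 h.symm)
  · refine (connectedComponentIn_subset _ _).trans (Set.iUnion₂_subset fun j hj => ?_)
    by_cases h : j = i
    · exact h ▸ Set.subset_union_left
    · exact (Set.subset_biUnion_of_mem (u := U) (show j ∈ s \ {i} from ⟨hj, h⟩)).trans
        Set.subset_union_right

end General

/-! ### Dominant regions and the complement of the amoeba -/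

namespace MvLaurent

theorem toReal_injective {n : ℕ} : Function.Injective (toReal (n := n)) := fun _ _ h =>
  funext fun j => Int.cast_injective (congrFun h j)

/-- The modulus of the monomial of exponent `a` of `f`, as a function of the logarithms of the
moduli of the variables. -/
noncomputable def monomialNorm {n : ℕ} (f : MvLaurent n) (a : Fin n → ℤ) (w : Fin n → ℝ) : ℝ :=
  ‖f.coeff a‖ * Real.exp (toReal a ⬝ᵥ w)

/-- The set of points at which the monomial of exponent `a` of `f` dominates the sum of the
others. -/
def dominantRegion {n : ℕ} (f : MvLaurent n) (a : Fin n → ℤ) : Set (Fin n → ℝ) :=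
  {w | ∑ b ∈ f.supp.erase a, f.monomialNorm b w < f.monomialNorm a w}

variable {n : ℕ} {f : MvLaurent n}

theorem monomialNorm_nonneg (a : Fin n → ℤ) (w : Fin n → ℝ) : 0 ≤ f.monomialNorm a w :=
  mul_nonneg (norm_nonneg _) (Real.exp_pos _).le

theorem monomialNorm_pos {a : Fin n → ℤ} (ha : a ∈ f.supp) (w : Fin n → ℝ) :
    0 < f.monomialNorm a w :=
  mul_pos (norm_pos_iff.2 (Finsupp.mem_support_iff.1 ha)) (Real.exp_pos _)

@[fun_prop]
theorem continuous_monomialNorm (a : Fin n → ℤ) : Continuous (f.monomialNorm a) := by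
  unfold monomialNorm dotProduct
  fun_prop

theorem monomialNorm_add (a : Fin n → ℤ) (w v : Fin n → ℝ) :
    f.monomialNorm a (w + v) = Real.exp (toReal a ⬝ᵥ v) * f.monomialNorm a w := by
  rw [monomialNorm, monomialNorm, dotProduct_add, Real.exp_add]
  ring

theorem isOpen_dominantRegion (a : Fin n → ℤ) : IsOpen (f.dominantRegion a) :=
  isOpen_lt (by fun_prop) (by fun_prop)

/-- Dividing by the dominant exponential makes one side constant and leaves a convex sum of
exponentials on the other, whence convexity of the region. -/
theorem dominantRegion_eq_sublevel (a : Fin n → ℤ) :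
    f.dominantRegion a = {w | w ∈ Set.univ ∧ ∑ b ∈ f.supp.erase a,
      ‖f.coeff b‖ * Real.exp ((toReal b - toReal a) ⬝ᵥ w) < ‖f.coeff a‖} := by
  ext w
  have h : ∀ b, ‖f.coeff b‖ * Real.exp ((toReal b - toReal a) ⬝ᵥ w) =
      f.monomialNorm b w / Real.exp (toReal a ⬝ᵥ w) := fun b => by
    rw [sub_dotProduct, Real.exp_sub, monomialNorm, mul_div_assoc]
  simp only [h, ← Finset.sum_div, dominantRegion, Set.mem_ofPred_eq, Set.mem_univ, true_and]
  rw [div_lt_iff₀ (Real.exp_pos _), ← monomialNorm]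

theorem convex_dominantRegion (a : Fin n → ℤ) : Convex ℝ (f.dominantRegion a) := by
  rw [dominantRegion_eq_sublevel]
  refine ConvexOn.convex_lt ?_ _
  have hb : ∀ b, ConvexOn ℝ Set.univ fun w : Fin n → ℝ =>
      ‖f.coeff b‖ * Real.exp ((toReal b - toReal a) ⬝ᵥ w) := fun b =>
    (convexOn_exp.comp_linearMap (dotProductBilin ℝ ℝ (toReal b - toReal a))).smul
      (norm_nonneg (f.coeff b))
  induction f.supp.erase a using Finset.induction_on with
  | empty => simpa using convexOn_const (0 : ℝ) convex_univ
  | insert b s hbs ih =>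
    simp only [Finset.sum_insert hbs]
    exact (hb b).add ih

theorem pairwiseDisjoint_dominantRegion :
    (f.supp : Set (Fin n → ℤ)).PairwiseDisjoint f.dominantRegion := by
  intro a ha b hb hab
  rw [Function.onFun, Set.disjoint_left]
  intro w h₁ h₂
  have h₃ := Finset.single_le_sum (f := fun c => f.monomialNorm c w)
    (fun c _ => monomialNorm_nonneg c w) (Finset.mem_erase.2 ⟨hab.symm, hb⟩)
  have h₄ := Finset.single_le_sum (f := fun c => f.monomialNorm c w)
    (fun c _ => monomialNorm_nonneg c w) (Finset.mem_erase.2 ⟨hab, ha⟩)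
  exact lt_asymm (h₃.trans_lt h₁) (h₄.trans_lt h₂)

theorem norm_prod_zpow (z : Fin n → ℂˣ) (a : Fin n → ℤ) :
    ‖∏ j, (z j : ℂ) ^ a j‖ = Real.exp (toReal a ⬝ᵥ logAbs z) := by
  rw [norm_prod, dotProduct, Real.exp_sum]
  refine Finset.prod_congr rfl fun j _ => ?_
  rw [norm_zpow, toReal, logAbs, mul_comm, Real.exp_mul,
    Real.exp_log (norm_pos_iff.2 (z j).ne_zero), Real.rpow_intCast]

theorem dominantRegion_subset_compl_amoeba {a : Fin n → ℤ} (ha : a ∈ f.supp) :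
    f.dominantRegion a ⊆ f.amoebaᶜ := by
  rintro w hw ⟨z, hz, rfl⟩
  have hz' : f.eval z = 0 := hz
  rw [eval, ← Finset.add_sum_erase _ _ ha] at hz'
  have h := norm_sum_le (f.supp.erase a) fun b => f.coeff b * ∏ j, (z j : ℂ) ^ b j
  rw [← norm_neg, ← eq_neg_of_add_eq_zero_left hz'] at h
  simp only [norm_mul, norm_prod_zpow] at h
  exact absurd hw (not_lt.2 h)

theorem exists_logAbs_eq (w θ : Fin n → ℝ) : ∃ z : Fin n → ℂˣ, logAbs z = w ∧
    ∀ a : Fin n → ℤ, ∏ j, (z j : ℂ) ^ a j =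
      Real.exp (toReal a ⬝ᵥ w) * Complex.exp ((toReal a ⬝ᵥ θ : ℝ) * Complex.I) := by
  refine ⟨fun j => Units.mk0 (Complex.exp (w j + θ j * Complex.I)) (Complex.exp_ne_zero _),
    ?_, fun a => ?_⟩
  · funext j
    simp [logAbs, Complex.norm_exp]
  · rw [Complex.ofReal_exp, ← Complex.exp_add]
    simp only [Units.val_mk0, ← Complex.exp_int_mul, ← Complex.exp_sum]
    congr 1
    simp only [dotProduct, toReal, Complex.ofReal_sum, Finset.sum_mul, ← Finset.sum_add_distrib]
    refine Finset.sum_congr rfl fun j _ => ?_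
    push_cast
    ring

theorem exists_dotProduct_add_eq
    (hf : AffineIndependent ℝ fun a : f.supp => toReal (a : Fin n → ℤ)) (φ : (Fin n → ℤ) → ℝ) :
    ∃ (v : Fin n → ℝ) (c : ℝ), ∀ a ∈ f.supp, toReal a ⬝ᵥ v + c = φ a := by
  obtain ⟨v, c, h⟩ := hf.exists_dotProduct_add_eq fun a => φ a
  exact ⟨v, c, fun a ha => h ⟨a, ha⟩⟩

/-- The failure of every dominance inequality is exactly the polygon condition for closing up to ρ =
0. -/
theorem mem_amoeba_of_forall_notMem
    (hf : AffineIndependent ℝ fun a : f.supp => toReal (a : Fin n → ℤ)) {w : Fin n → ℝ}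
    (hw : ∀ a ∈ f.supp, w ∉ f.dominantRegion a) : w ∈ f.amoeba := by
  obtain ⟨u, hu, hsum⟩ := exists_unit_sum_eq f.supp (fun a => f.monomialNorm a w)
    (fun a _ => monomialNorm_nonneg a w) le_rfl
    (Finset.sum_nonneg fun a _ => monomialNorm_nonneg a w) (fun a ha => by
      rw [← Finset.add_sum_erase _ _ ha]
      have h : ¬ ∑ b ∈ f.supp.erase a, f.monomialNorm b w < f.monomialNorm a w := hw a ha
      linarith)
  -- Affine independence only gives interpolation up to the constant c, which becomes a phase common
  -- to all terms and does not affect vanishing.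
  obtain ⟨θ, c, hθ⟩ := exists_dotProduct_add_eq hf fun a => (u a).arg - (f.coeff a).arg
  obtain ⟨z, hz, hmon⟩ := exists_logAbs_eq w θ
  refine ⟨z, ?_, hz⟩
  have hterm : ∀ a ∈ f.supp, f.coeff a * ∏ j, (z j : ℂ) ^ a j =
      Complex.exp (-c * Complex.I) * (u a * (f.monomialNorm a w : ℝ)) := by
    intro a ha
    have h1 : toReal a ⬝ᵥ θ = (u a).arg - (f.coeff a).arg - c := by linarith [hθ a ha]
    have h2 : u a = Complex.exp ((u a).arg * Complex.I) := by
      simpa [hu a] using (Complex.norm_mul_exp_arg_mul_I (u a)).symm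
    rw [hmon, h1, monomialNorm]
    nth_rw 1 [← Complex.norm_mul_exp_arg_mul_I (f.coeff a)]
    nth_rw 2 [h2]
    have h3 : Complex.exp (((u a).arg - (f.coeff a).arg - c : ℝ) * Complex.I) =
        Complex.exp (-c * Complex.I) * Complex.exp ((u a).arg * Complex.I) *
          Complex.exp (-((f.coeff a).arg * Complex.I)) := by
      rw [← Complex.exp_add, ← Complex.exp_add]
      congr 1
      push_cast
      ring
    rw [h3, Complex.exp_neg]
    have h4 := Complex.exp_ne_zero ((f.coeff a).arg * Complex.I)
    push_cast
    field_simp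
  change f.eval z = 0
  rw [eval, Finset.sum_congr rfl hterm, ← Finset.mul_sum, hsum]
  simp

theorem compl_amoeba_eq
    (hf : AffineIndependent ℝ fun a : f.supp => toReal (a : Fin n → ℤ)) :
    f.amoebaᶜ = ⋃ a ∈ (f.supp : Set (Fin n → ℤ)), f.dominantRegion a := by
  refine subset_antisymm (fun w hw => ?_)
    (Set.iUnion₂_subset fun a ha => dominantRegion_subset_compl_amoeba ha)
  by_contra h
  simp only [Set.mem_iUnion, not_exists] at h
  exact hw (mem_amoeba_of_forall_notMem hf h)

/-- A direction along which the monomial of exponent `a` outgrows all others. -/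
theorem exists_direction (hn : 1 ≤ n)
    (hf : AffineIndependent ℝ fun a : f.supp => toReal (a : Fin n → ℤ)) {a : Fin n → ℤ}
    (ha : a ∈ f.supp) :
    ∃ v : Fin n → ℝ, v ≠ 0 ∧ ∀ b ∈ f.supp.erase a, toReal b ⬝ᵥ v + 1 ≤ toReal a ⬝ᵥ v := by
  rcases (f.supp.erase a).eq_empty_or_nonempty with h | ⟨b, hb⟩
  · exact ⟨1, fun h1 => one_ne_zero (congrFun h1 ⟨0, hn⟩), by simp [h]⟩
  · obtain ⟨v, c, hv⟩ := exists_dotProduct_add_eq hf (fun b => if b = a then 1 else 0)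
    have key : ∀ b ∈ f.supp.erase a, toReal b ⬝ᵥ v + 1 ≤ toReal a ⬝ᵥ v := by
      intro b hb
      have h1 := hv a ha
      have h2 := hv b (Finset.mem_of_mem_erase hb)
      rw [if_pos rfl] at h1
      rw [if_neg (Finset.ne_of_mem_erase hb)] at h2
      linarith
    refine ⟨v, fun h0 => ?_, key⟩
    have := key b hb
    simp only [h0, dotProduct_zero] at this
    linarith

/-! ### Nonemptiness and unboundedness of the regions -/

theorem add_smul_mem_dominantRegion {a : Fin n → ℤ} {v w : Fin n → ℝ}
    (hv : ∀ b ∈ f.supp.erase a, toReal b ⬝ᵥ v + 1 ≤ toReal a ⬝ᵥ v)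
    (hw : w ∈ f.dominantRegion a) {t : ℝ} (ht : 0 ≤ t) : w + t • v ∈ f.dominantRegion a := by
  have hw' : ∑ b ∈ f.supp.erase a, f.monomialNorm b w < f.monomialNorm a w := hw
  change ∑ b ∈ f.supp.erase a, f.monomialNorm b (w + t • v) < f.monomialNorm a (w + t • v)
  simp only [monomialNorm_add, dotProduct_smul, smul_eq_mul]
  calc _ ≤ ∑ b ∈ f.supp.erase a, Real.exp (t * toReal a ⬝ᵥ v) * f.monomialNorm b w := by
        refine Finset.sum_le_sum fun b hb => ?_
        refine mul_le_mul_of_nonneg_right (Real.exp_le_exp.2 ?_) (monomialNorm_nonneg b w)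
        exact mul_le_mul_of_nonneg_left (by linarith [hv b hb]) ht
    _ < _ := by
        rw [← Finset.mul_sum]
        exact mul_lt_mul_of_pos_left hw' (Real.exp_pos _)

theorem dominantRegion_nonempty {a : Fin n → ℤ} {v : Fin n → ℝ} (ha : a ∈ f.supp)
    (hv : ∀ b ∈ f.supp.erase a, toReal b ⬝ᵥ v + 1 ≤ toReal a ⬝ᵥ v) :
    (f.dominantRegion a).Nonempty := by
  set S := ∑ b ∈ f.supp.erase a, f.monomialNorm b 0
  have hS : 0 ≤ S := Finset.sum_nonneg fun b _ => monomialNorm_nonneg b 0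
  have hpos := monomialNorm_pos ha 0
  -- Moving by t along v gains the monomial of a a factor of at least exp t over each other one, and
  -- exp t ≥ t + 1 > S / `f.monomialNorm a 0`.
  set t := S / f.monomialNorm a 0
  have ht : 0 ≤ t := by positivity
  refine ⟨0 + t • v, ?_⟩
  change ∑ b ∈ f.supp.erase a, f.monomialNorm b (0 + t • v) < f.monomialNorm a (0 + t • v)
  simp only [monomialNorm_add, dotProduct_smul, smul_eq_mul]
  have hlt : S < Real.exp t * f.monomialNorm a 0 := by
    rw [← div_lt_iff₀ hpos]
    exact (lt_add_one t).trans_le (Real.add_one_le_exp t)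
  calc _ ≤ ∑ b ∈ f.supp.erase a,
        Real.exp (t * toReal a ⬝ᵥ v - t) * f.monomialNorm b 0 := by
        refine Finset.sum_le_sum fun b hb => ?_
        refine mul_le_mul_of_nonneg_right (Real.exp_le_exp.2 ?_) (monomialNorm_nonneg b 0)
        nlinarith [hv b hb]
    _ < Real.exp (t * toReal a ⬝ᵥ v - t) * (Real.exp t * f.monomialNorm a 0) := by
        rw [← Finset.mul_sum]
        exact mul_lt_mul_of_pos_left hlt (Real.exp_pos _)
    _ = _ := by rw [← mul_assoc, ← Real.exp_add, sub_add_cancel]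

theorem not_isBounded_dominantRegion {a : Fin n → ℤ} {v : Fin n → ℝ} (ha : a ∈ f.supp)
    (hv0 : v ≠ 0) (hv : ∀ b ∈ f.supp.erase a, toReal b ⬝ᵥ v + 1 ≤ toReal a ⬝ᵥ v) :
    ¬ Bornology.IsBounded (f.dominantRegion a) := by
  intro hb
  obtain ⟨w, hw⟩ := dominantRegion_nonempty ha hv
  obtain ⟨C, hC⟩ := hb.exists_norm_le
  have hvpos := norm_pos_iff.2 hv0
  have hC0 : 0 ≤ C := (norm_nonneg w).trans (hC w hw)
  -- This length carries w out of the ball of radius C.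
  set t := (C + ‖w‖ + 1) / ‖v‖
  have ht : 0 ≤ t := by positivity
  have h1 := hC _ (add_smul_mem_dominantRegion hv hw ht)
  have h2 : ‖t • v‖ = C + ‖w‖ + 1 := by
    rw [norm_smul, Real.norm_of_nonneg ht, div_mul_cancel₀ _ hvpos.ne']
  have h3 : ‖t • v‖ ≤ ‖w + t • v‖ + ‖w‖ := by
    simpa using norm_sub_le (w + t • v) w
  linarith

theorem complementComponents_eq (hn : 1 ≤ n)
    (hf : AffineIndependent ℝ fun a : f.supp => toReal (a : Fin n → ℤ)) :
    f.complementComponents = f.dominantRegion '' (f.supp : Set (Fin n → ℤ)) := by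
  have hcomp : ∀ a ∈ (f.supp : Set (Fin n → ℤ)), ∀ w ∈ f.dominantRegion a,
      connectedComponentIn f.amoebaᶜ w = f.dominantRegion a := fun a ha w hw => by
    rw [compl_amoeba_eq hf]
    exact connectedComponentIn_biUnion_eq (fun b _ => isOpen_dominantRegion b)
      (fun b _ => (convex_dominantRegion b).isPreconnected) pairwiseDisjoint_dominantRegion ha hw
  ext C
  constructor
  · rintro ⟨w, hw, rfl⟩
    rw [compl_amoeba_eq hf] at hw
    obtain ⟨a, ha, hwa⟩ := Set.mem_iUnion₂.1 hw
    exact ⟨a, ha, (hcomp a ha w hwa).symm⟩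
  · rintro ⟨a, ha, rfl⟩
    obtain ⟨v, -, hv⟩ := exists_direction hn hf ha
    obtain ⟨w, hw⟩ := dominantRegion_nonempty ha hv
    exact ⟨w, dominantRegion_subset_compl_amoeba ha hw, (hcomp a ha w hw).symm⟩

theorem MaximallySparse.newtonVertices_eq (hf : f.MaximallySparse) :
    f.newtonVertices = toReal '' (f.supp : Set (Fin n → ℤ)) := by
  refine subset_antisymm extremePoints_convexHull_subset ?_
  rintro _ ⟨a, ha, rfl⟩
  by_contra h
  exact Finsupp.mem_support_iff.1 ha (hf a h)

/-- Extreme points of a convex hull lie among its generators, so the exponents form a subfamily of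
the simplex's points. -/
theorem MaximallySparse.affineIndependent (hf : f.MaximallySparse)
    (hs : IsSimplexSet f.newtonPolytope) :
    AffineIndependent ℝ fun a : f.supp => toReal (a : Fin n → ℤ) := by
  obtain ⟨k, s, hs⟩ := hs
  have hsub : toReal '' (f.supp : Set (Fin n → ℤ)) ⊆ Set.range s.points := by
    rw [← hf.newtonVertices_eq, newtonVertices, hs]
    exact extremePoints_convexHull_subset
  have h := s.independent.range.mono hsub
  exact h.comp_embedding ⟨fun a : f.supp => ⟨toReal (a : Fin n → ℤ), a, a.2, rfl⟩,
    fun a b hab => Subtype.ext (toReal_injective (congrArg Subtype.val hab))⟩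

end MvLaurent

theorem mainTheorem12 (n : ℕ) (hn : 1 ≤ n) (f : MvLaurent n)
    (hsparse : f.MaximallySparse) (hsimplex : IsSimplexSet f.newtonPolytope) :
    f.HasSolidAmoeba ∧
      ∀ C ∈ f.complementComponents, ¬ Bornology.IsBounded C := by
  have hf := hsparse.affineIndependent hsimplex
  rw [MvLaurent.HasSolidAmoeba, MvLaurent.complementComponents_eq hn hf]
  constructor
  · rw [hsparse.newtonVertices_eq, MvLaurent.toReal_injective.encard_image]
    -- Distinct exponents have disjoint nonempty regions.
    refine Set.InjOn.encard_image fun a ha b hb hab => ?_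
    by_contra hne
    obtain ⟨v, -, hv⟩ := MvLaurent.exists_direction hn hf ha
    obtain ⟨w, hw⟩ := MvLaurent.dominantRegion_nonempty ha hv
    exact Set.disjoint_left.1 (MvLaurent.pairwiseDisjoint_dominantRegion ha hb hne) hw (hab ▸ hw)
  · rintro _ ⟨a, ha, rfl⟩
    obtain ⟨v, hv0, hv⟩ := MvLaurent.exists_direction hn hf ha
    exact MvLaurent.not_isBounded_dominantRegion ha hv0 hv
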